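/- Let $d\ge 1$ and $0<\alpha<\beta<1/2$ with $\Gamma:=(2\beta)^d-(2\alpha)^d>1/2$. For $\sigma>0$, $\zeta\in\mathbb R$ and $n\ge 1$, let $T_n^d=(\mathbb Z/n\mathbb Z)^d$ be the $d$-dimensional lattice torus with its nearest-neighbour edges and its $\ell_\infty$ metric $d_\infty^T$ (the quotient of the $\ell_\infty$ metric on $\mathbb Z^d$). Let $G_n=G_n(\alpha,\beta,\sigma,\zeta)=(V_n,E_n)$ be the random graph obtained from $T_n^d$ by joining, independently for each unordered pair $\{u,v\}$ with $\alpha n\le d_\infty^T(u,v)\le\beta n$, the vertices $u$ and $v$ by a "long edge" with probability $p_n=\sigma n^{-d}(\ln n)^{\zeta}$ (which lies in $[0,1]$ for all large $n$). So $|V_n|=n^d$. For $S\subset V_n$ let $E(S,S^c)$ be the number of edges of $G_n$ between $S$ and $S^c$, and let $\mathrm{vol}(S)=\sum_{u\in S}\deg_{G_n}(u)$. For $0<a<1$ put $$\hat\iota=\hat\iota(G_n,a):=\min_{\emptyset\ne S\subset V_n,\ |S|\le(1-a)n^d}\frac{E(S,S^c)}{\mathrm{vol}(S)}.$$ (i)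 For every $0<\zeta<1$, $\sigma>0$ and $a\in(0,1)$ there is a constant $C>0$ such that $$\lim_{n\to\infty}\mathbb P\bigl(\hat\iota\ge C(\ln n)^{-2}\bigr)=1.$$ If $\zeta=0$, there is $\sigma_0>0$ such that for every $\sigma\ge\sigma_0$ and $a\in(0,1)$ there is a constant $C>0$ with the same property. (ii) For every $\zeta>1$, $\sigma>0$ and $a\in(0,1)$ there is a constant $C>0$ such that $$\lim_{n\to\infty}\mathbb P\bigl(\hat\iota\ge C\bigr)=1.$$ If $\zeta=1$, there is $\sigma_0>0$ such that for every $\sigma\ge\sigma_0$ and $a\in(0,1)$ there is a constant $C>0$ with the same property. Here $\sigma_0$ depends only on $d,\alpha,\beta$, and $C$ only on $d,\alpha,\beta,\zeta,\sigma,a$; neither depends on $n$. -/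

import Mathlib

open Filter Topology MeasureTheory ProbabilityTheory

/-- Vertices of the `d`-dimensional lattice torus of side `n` (so there are `n ^ d` of them): the
coordinates are residues mod `n`, represented by `0, …, n - 1`. -/
abbrev TorusVertex (d n : ℕ) : Type := Fin d → Fin n

/-- Distance between two residues on the cycle of length `n`. -/
def cycleDist {n : ℕ} (x y : Fin n) : ℕ :=
  min ((x : ℤ) - (y : ℤ)).natAbs (n - ((x : ℤ) - (y : ℤ)).natAbs)

/-- The `ℓ^∞` metric on the torus. -/
def torusDist {d n : ℕ} (u v : TorusVertex d n) : ℕ :=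
  Finset.univ.sup fun s : Fin d => cycleDist (u s) (v s)

theorem cycleDist_comm {n : ℕ} (x y : Fin n) : cycleDist x y = cycleDist y x := by
  unfold cycleDist
  omega

theorem cycleDist_self {n : ℕ} (x : Fin n) : cycleDist x x = 0 := by
  simp [cycleDist]

/-- The nearest neighbour graph of the torus: two vertices are adjacent when they differ in exactly
one coordinate, and there by one step of the cycle. -/
def torusGraph (d n : ℕ) : SimpleGraph (TorusVertex d n) where
  Adj u v := ∃ s : Fin d, cycleDist (u s) (v s) = 1 ∧ ∀ t : Fin d, t ≠ s → u t = v t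
  symm := ⟨fun u v ⟨s, h, h'⟩ => ⟨s, (cycleDist_comm (v s) (u s)).trans h, fun t ht => (h' t ht).symm⟩⟩
  loopless := ⟨fun u ⟨s, h, _⟩ => by simp [cycleDist_self] at h⟩

/-- The unordered pairs of vertices that may carry a long edge: those whose torus distance lies
between `α n` and `β n`. -/
def longPairs (d n : ℕ) (α β : ℝ) : Set (Sym2 (TorusVertex d n)) :=
  {e | ∃ u v : TorusVertex d n, e = s(u, v) ∧
    α * n ≤ (torusDist u v : ℝ) ∧ (torusDist u v : ℝ) ≤ β * n}

/-- The long edge probability `σ n^{-d} (ln n)^ζ`. It tends to `0` as `n → ∞`; it is truncated to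
`[0, 1]` so that it is a probability for the finitely many other `n` too. -/
noncomputable def longEdgeProb (d n : ℕ) (σ ζ : ℝ) : unitInterval :=
  Set.projIcc (0 : ℝ) 1 zero_le_one (σ / (n : ℝ) ^ d * Real.log n ^ ζ)

/-- The law of the set of long edges: each admissible pair is present independently with
probability `longEdgeProb d n σ ζ`, and no other pair is present. -/
noncomputable def longEdgeLaw (d n : ℕ) (α β σ ζ : ℝ) :
    Measure (Set (Sym2 (TorusVertex d n))) :=
  setBernoulli (longPairs d n α β) (longEdgeProb d n σ ζ)

/-- The modified Newman-Watts graph when `L` is the set of long edges. -/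
def nwGraph (d n : ℕ) (L : Set (Sym2 (TorusVertex d n))) : SimpleGraph (TorusVertex d n) :=
  torusGraph d n ⊔ SimpleGraph.fromEdgeSet L

open Classical in
/-- The number of edges of `G` with one end in `S` and the other end outside `S`. -/
noncomputable def edgeBoundary {V : Type*} [Fintype V] (G : SimpleGraph V) (S : Finset V) : ℕ :=
  (G.interedges S Sᶜ).card

open Classical in
/-- The volume of `S`: the sum of the degrees in `G` of its vertices. -/
noncomputable def vol {V : Type*} [Fintype V] (G : SimpleGraph V) (S : Finset V) : ℕ :=
  ∑ u ∈ S, G.degree u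

/-- The minimum of `edgeBoundary G S / vol G S` over the non-empty sets `S` of at most `(1 - a) |V|`
vertices. -/
noncomputable def isoHat {V : Type*} [Fintype V] (G : SimpleGraph V) (a : ℝ) : ℝ :=
  ⨅ S : {S : Finset V // S.Nonempty ∧ (S.card : ℝ) ≤ (1 - a) * Fintype.card V},
    (edgeBoundary G S.1 : ℝ) / (vol G S.1 : ℝ)

/-- The probability that the constant `isoHat`, with parameter `a`, of the modified Newman-Watts
graph is at least `b`. -/
noncomputable def probIsoHatGe (d n : ℕ) (α β σ ζ a b : ℝ) : ℝ :=
  (longEdgeLaw d n α β σ ζ).real {L | b ≤ isoHat (nwGraph d n L) a}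

/-! Fix `γ` strictly between `1/2` and `Γ`. For large `n` every vertex has at least `γ n^d`
admissible long partners, so a set `T` of at most half of the vertices has at least `(γ - 1/2) n^d
|T|` admissible pairs leaving it (`le_card_crossingPairs`). A Chernoff bound makes it exponentially
unlikely in `p n^d |T|`, with `p` the long edge probability, that few of them are present; what
remains is a union bound over `T`. When `p n^d` is at least a large multiple of `ln n`, the union
runs over all `T`: each failure has probability at most `n^{-(d+1)|T|}`, and `∑ x^|T|` over
non-empty `T` is at most `exp(x n^d) - 1`. When `p n^d` is only a large constant, a failure has
probability `exp(-c|T|)`, too much for all sets. But `T` can only fail to have `|T| / ln n` boundary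
edges if its torus boundary is already smaller than that. Since the torus is connected, such a `T`
is encoded by its directed torus boundary `D`, and `|D| ln n < |T|` turns `exp(-c|T|)` into
`n^{-c|D|}`, which beats the choice of `D` among the subsets of the `n^{2d}` ordered pairs. All
degrees are `O(max(ln n, (ln n)^ζ))` by a further union bound, and sets larger than half are handled
through their complements (`le_isoHat`). -/

/-! ### Chernoff bounds for Bernoulli random sets. -/

section BernoulliTails

variable {ι : Type*}

/-- The moment generating function of the number of elements of `F` in a Bernoulli set. -/
theorem mgf_card_infinitePi_bernoulli (u : Set ι) (p : unitInterval) (F : Finset ι)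
    (hF : (F : Set ι) ⊆ u) (t : ℝ) :
    mgf (∑ i ∈ F, fun ω : ι → Prop => Set.indicator {q : Prop | q} (fun _ => (1 : ℝ)) (ω i))
      (Measure.infinitePi fun i : ι => unitInterval.toNNReal p • Measure.dirac (i ∈ u) +
        unitInterval.toNNReal (unitInterval.symm p) • Measure.dirac False) t =
      (1 + p * (Real.exp t - 1)) ^ F.card := by
  have hmeas : Measurable (Set.indicator {q : Prop | q} fun _ => (1 : ℝ)) := .of_discrete
  have hind := iIndepFun_infinitePi (P := fun i : ι =>
    unitInterval.toNNReal p • Measure.dirac (i ∈ u) +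
        unitInterval.toNNReal (unitInterval.symm p) • Measure.dirac False)
    (X := fun _ => Set.indicator {q : Prop | q} fun _ => (1 : ℝ)) (fun _ => hmeas)
  have hsum := hind.mgf_sum (t := t)
    (fun i => hmeas.comp (measurable_pi_apply i)) F
  refine hsum.trans ?_
  rw [← Finset.prod_const]
  refine Finset.prod_congr rfl fun i hi => ?_
  have hiu : i ∈ u := hF hi
  have hmap := integral_map (μ := Measure.infinitePi fun i : ι =>
      unitInterval.toNNReal p • Measure.dirac (i ∈ u) +
        unitInterval.toNNReal (unitInterval.symm p) • Measure.dirac False)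
    (φ := Function.eval i) (measurable_pi_apply i).aemeasurable
    (f := fun q : Prop => Real.exp (t * Set.indicator {q : Prop | q} (fun _ => (1 : ℝ)) q))
    (Measurable.aestronglyMeasurable (by fun_prop))
  rw [Measure.infinitePi_map_eval] at hmap
  refine hmap.symm.trans ?_
  have hint : ∀ q : Prop, Integrable
      (fun q : Prop => Real.exp (t * Set.indicator {q : Prop | q} (fun _ => (1 : ℝ)) q))
      (Measure.dirac q) := fun q => integrable_dirac (by simp)
  rw [integral_add_measure ((hint _).smul_measure_nnreal) ((hint _).smul_measure_nnreal),
    integral_smul_nnreal_measure, integral_smul_nnreal_measure, integral_dirac, integral_dirac]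
  simp [hiu, NNReal.smul_def]
  ring

open Classical in
-- Moves the count to the product space `ι → Prop`, where it is a sum of independent indicators and
-- its moment generating function is available.
theorem setBernoulli_real_card_eq (u : Set ι) (p : unitInterval) (F : Finset ι)
    (B : Set ℝ) :
    (setBernoulli u p).real {L | ((F.filter (· ∈ L)).card : ℝ) ∈ B} =
      (Measure.infinitePi fun i : ι => unitInterval.toNNReal p • Measure.dirac (i ∈ u) +
        unitInterval.toNNReal (unitInterval.symm p) • Measure.dirac False).real
      {ω | (∑ i ∈ F, fun ω : ι → Prop =>
        Set.indicator {q : Prop | q} (fun _ => (1 : ℝ)) (ω i)) ω ∈ B} := by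
  rw [measureReal_def, setBernoulli_apply', measureReal_def]
  congr 3
  ext ω
  simp [Set.indicator_apply]

theorem measurable_sum_indicator_prop (F : Finset ι) :
    Measurable (∑ i ∈ F, fun ω : ι → Prop =>
      Set.indicator {q : Prop | q} (fun _ => (1 : ℝ)) (ω i)) := by
  have hmeas : Measurable (Set.indicator {q : Prop | q} fun _ => (1 : ℝ)) := .of_discrete
  have h := Finset.measurable_sum F fun i _ => hmeas.comp (measurable_pi_apply (X := fun _ : ι => Prop) i)
  convert h using 1
  ext ω
  simp

theorem integrable_exp_sum_indicator_prop (F : Finset ι) (t : ℝ) (μ : Measure (ι → Prop))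
    [IsFiniteMeasure μ] :
    Integrable (fun ω => Real.exp (t * (∑ i ∈ F, fun ω : ι → Prop =>
      Set.indicator {q : Prop | q} (fun _ => (1 : ℝ)) (ω i)) ω)) μ := by
  refine Integrable.of_bound
    ((measurable_sum_indicator_prop F).const_mul t).exp.aestronglyMeasurable
    (Real.exp (|t| * F.card)) (ae_of_all _ fun ω => ?_)
  rw [Real.norm_eq_abs, Real.abs_exp, Real.exp_le_exp]
  refine (le_abs_self _).trans ?_
  rw [abs_mul]
  refine mul_le_mul_of_nonneg_left ?_ (abs_nonneg _)
  rw [Finset.sum_apply]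
  refine (Finset.abs_sum_le_sum_abs _ _).trans ?_
  refine (Finset.sum_le_card_nsmul _ _ 1 fun i _ => ?_).trans (by simp)
  by_cases h : ω i <;> simp [h]

open Classical in
-- Chernoff's bound with exponential parameter `1`; the factor `2` comes from `e - 1 ≤ 2`.
theorem setBernoulli_real_card_ge_le (u : Set ι) (p : unitInterval) (F : Finset ι)
    (hF : (F : Set ι) ⊆ u) (t : ℝ) :
    (setBernoulli u p).real {L | t ≤ ((F.filter (· ∈ L)).card : ℝ)} ≤
      Real.exp (2 * (p * F.card) - t) := by
  refine (setBernoulli_real_card_eq u p F (Set.Ici t)).le.trans ?_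
  refine (measure_ge_le_exp_mul_mgf t zero_le_one
    (integrable_exp_sum_indicator_prop F 1 _)).trans ?_
  rw [mgf_card_infinitePi_bernoulli u p F hF, sub_eq_neg_add (2 * _) t, Real.exp_add]
  have hp := p.2.1
  have he : Real.exp 1 - 1 ≤ 2 := by linarith [Real.exp_one_lt_d9]
  have he' : 0 ≤ Real.exp 1 - 1 := by linarith [Real.exp_one_gt_d9]
  refine mul_le_mul (by simp) ?_ (by positivity) (by positivity)
  calc (1 + p * (Real.exp 1 - 1)) ^ F.card ≤ (Real.exp (2 * p)) ^ F.card := by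
        refine pow_le_pow_left₀ (by positivity) ?_ _
        nlinarith [Real.add_one_le_exp (2 * (p : ℝ))]
    _ = _ := by rw [← Real.exp_nat_mul]; ring_nf

open Classical in
-- Chernoff's bound with exponential parameter `-1`; the factor `1/2` comes from `1/e ≤ 1/2`.
theorem setBernoulli_real_card_le_le (u : Set ι) (p : unitInterval) (F : Finset ι)
    (hF : (F : Set ι) ⊆ u) (t : ℝ) :
    (setBernoulli u p).real {L | ((F.filter (· ∈ L)).card : ℝ) ≤ t} ≤
      Real.exp (t - p * F.card / 2) := by
  refine (setBernoulli_real_card_eq u p F (Set.Iic t)).le.trans ?_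
  refine (measure_le_le_exp_mul_mgf t (t := -1) (by norm_num)
    (integrable_exp_sum_indicator_prop F (-1) _)).trans ?_
  rw [mgf_card_infinitePi_bernoulli u p F hF, sub_eq_add_neg t, Real.exp_add]
  have hp := p.2.1
  have hp' := p.2.2
  have he : Real.exp (-1) ≤ 1 / 2 := by linarith [Real.exp_neg_one_lt_d9]
  have he' := Real.exp_pos (-1)
  have h0 : 0 ≤ 1 + p * (Real.exp (-1) - 1) := by nlinarith
  refine mul_le_mul (by simp) ?_ (by positivity) (by positivity)
  calc (1 + p * (Real.exp (-1) - 1)) ^ F.card ≤ (Real.exp (-(p / 2))) ^ F.card := by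
        refine pow_le_pow_left₀ h0 ?_ _
        nlinarith [Real.add_one_le_exp (-((p : ℝ) / 2))]
    _ = _ := by rw [← Real.exp_nat_mul]; ring_nf

end BernoulliTails

/-- If `φ` is injective with non-empty values then `∑ x ^ #(φ T)` is small. -/
theorem sum_pow_card_le_exp {κ W : Type*} [Fintype W] (s : Finset κ) (φ : κ → Finset W)
    (hφ : Set.InjOn φ s) (hne : ∀ T ∈ s, (φ T).Nonempty) {x : ℝ} (hx : 0 ≤ x) :
    ∑ T ∈ s, x ^ (φ T).card ≤ Real.exp (x * Fintype.card W) - 1 := by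
  classical
  have h1 : ∑ T ∈ s, x ^ (φ T).card = ∑ D ∈ s.image φ, x ^ D.card :=
    (Finset.sum_image (f := fun D : Finset W => x ^ D.card) hφ).symm
  have h2 : ∅ ∉ s.image φ := by
    simp only [Finset.mem_image, not_exists, not_and]
    exact fun T hT => (hne T hT).ne_empty
  have h3 : ∑ D : Finset W, x ^ D.card = (x + 1) ^ Fintype.card W := by
    simpa using Fintype.sum_pow_mul_eq_add_pow W x 1
  have h4 : ∑ D ∈ insert ∅ (s.image φ), x ^ D.card ≤ ∑ D : Finset W, x ^ D.card :=
    Finset.sum_le_sum_of_subset_of_nonneg (Finset.subset_univ _) fun _ _ _ => by positivity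
  rw [Finset.sum_insert h2, h3] at h4
  have h5 : (x + 1) ^ Fintype.card W ≤ Real.exp (x * Fintype.card W) := by
    rw [mul_comm, Real.exp_nat_mul]
    exact pow_le_pow_left₀ (by positivity) (Real.add_one_le_exp x) _
  simp only [Finset.card_empty, pow_zero] at h4
  linarith

/-! ### Directed edge boundaries in connected graphs. -/

section Boundary

theorem SimpleGraph.Preconnected.interedges_compl_nonempty {V : Type*} [Fintype V]
    [DecidableEq V] {G : SimpleGraph V} [DecidableRel G.Adj] (hG : G.Preconnected) {T : Finset V} (hT : T.Nonempty)
    (hT' : Tᶜ.Nonempty) : (G.interedges T Tᶜ).Nonempty := by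
  obtain ⟨u, hu⟩ := hT
  obtain ⟨v, hv⟩ := hT'
  obtain ⟨w⟩ := hG u v
  obtain ⟨e, -, he, he'⟩ := w.exists_boundary_dart (T : Set V) hu (by simpa using hv)
  exact ⟨(e.fst, e.snd), by
    rw [SimpleGraph.mk_mem_interedges_iff]
    exact ⟨he, by simpa using he', e.adj⟩⟩

/-- In a connected graph a set is determined by its directed edge boundary. -/
theorem SimpleGraph.Preconnected.eq_of_interedges_compl_eq {V : Type*} [Fintype V]
    [DecidableEq V] {G : SimpleGraph V} [DecidableRel G.Adj] (hG : G.Preconnected) {T T' : Finset V}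
    (hne : (G.interedges T Tᶜ).Nonempty)
    (h : G.interedges T Tᶜ = G.interedges T' T'ᶜ) : T = T' := by
  have hiff : ∀ x y, (x ∈ T ∧ y ∉ T ∧ G.Adj x y) ↔ (x ∈ T' ∧ y ∉ T' ∧ G.Adj x y) := by
    intro x y
    have := congrArg ((x, y) ∈ ·) h
    simpa [SimpleGraph.mk_mem_interedges_iff] using this
  -- A boundary edge supplies a first vertex where `T` and `T'` agree; without one, `∅` and the
  -- whole vertex set could not be told apart.
  obtain ⟨⟨u, v⟩, huv⟩ := hne
  rw [SimpleGraph.mk_mem_interedges_iff, Finset.mem_compl] at huv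
  have hu : u ∈ T' := ((hiff u v).1 huv).1
  -- Agreement spreads along edges: once the side of `a` is known, membership of `b` is read off
  -- from whether the edge, oriented outwards, lies in the common boundary.
  have key : ∀ {a b : V}, G.Walk a b → (a ∈ T ↔ a ∈ T') → (b ∈ T ↔ b ∈ T') := by
    intro a b w
    induction w with
    | nil => exact id
    | @cons a b c hab _ ih =>
      intro ha
      refine ih ?_
      by_cases haT : a ∈ T
      · have := hiff a b
        simp only [haT, ha.1 haT, hab, true_and, and_true] at this
        exact not_iff_not.1 this
      · have := hiff b a
        simpa only [haT, ha.not.1 haT, hab.symm, and_true, not_false_eq_true] using this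
  ext w
  obtain ⟨p⟩ := hG u w
  exact key p (iff_of_true huv.1 hu)

end Boundary

/-! ### Connectedness, degrees and annuli of the torus. -/

section Torus

theorem cycleDist_eq_one_of_succ {n : ℕ} {x y : Fin n} (h : (y : ℕ) = x + 1) :
    cycleDist x y = 1 := by
  unfold cycleDist
  omega

theorem torusGraph_reachable_update_zero {d n : ℕ} (u : TorusVertex d n) (s : Fin d)
    (hn : 0 < n) (k : ℕ) (hk : k < n) :
    (torusGraph d n).Reachable (Function.update u s ⟨0, hn⟩) (Function.update u s ⟨k, hk⟩) := by
  induction k with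
  | zero => exact SimpleGraph.Reachable.refl _
  | succ k ih =>
    refine (ih (by omega)).trans (SimpleGraph.Adj.reachable ⟨s, ?_, fun t ht => ?_⟩)
    · simpa using cycleDist_eq_one_of_succ rfl
    · simp [ht]

theorem torusGraph_reachable_update {d n : ℕ} (u : TorusVertex d n) (s : Fin d) (x : Fin n) :
    (torusGraph d n).Reachable u (Function.update u s x) := by
  have hn : 0 < n := x.pos
  have h := torusGraph_reachable_update_zero u s hn (u s) (u s).2
  have h' := torusGraph_reachable_update_zero u s hn x x.2
  simpa using h.symm.trans h'

theorem torusGraph_preconnected (d n : ℕ) : (torusGraph d n).Preconnected := by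
  intro u v
  have h : ∀ I : Finset (Fin d), (torusGraph d n).Reachable u (I.piecewise v u) := by
    intro I
    induction I using Finset.induction_on with
    | empty => simp
    | insert s I hs ih =>
      rw [Finset.piecewise_insert]
      exact ih.trans (torusGraph_reachable_update _ _ _)
  simpa using h Finset.univ

theorem card_cycleDist_eq_one_le {n : ℕ} (x : Fin n) :
    (Finset.univ.filter fun y => cycleDist x y = 1).card ≤ 4 := by
  -- The candidates are the two neighbours and their wrapped versions; this crude bound only affects
  -- constants.
  refine (Finset.card_le_card_of_injOn (fun y : Fin n => (y : ℤ))
    (t := {(x : ℤ) - 1, (x : ℤ) + 1, (x : ℤ) - (n - 1), (x : ℤ) + (n - 1)}) ?_ ?_).trans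
    Finset.card_le_four
  · intro y hy
    replace hy : cycleDist x y = 1 := by simpa using hy
    unfold cycleDist at hy
    simp only [Finset.coe_insert, Finset.coe_singleton, Set.mem_insert_iff, Set.mem_singleton_iff]
    omega
  · intro y _ z _ h
    exact Fin.ext (by simpa using h)

open Classical in
theorem torusGraph_degree_le {d n : ℕ} (u : TorusVertex d n) :
    (torusGraph d n).degree u ≤ 4 * d := by
  have hsub : (torusGraph d n).neighborFinset u ⊆ Finset.univ.biUnion fun s =>
      (Finset.univ.filter fun y => cycleDist (u s) y = 1).image (Function.update u s) := by
    intro v hv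
    rw [SimpleGraph.mem_neighborFinset] at hv
    obtain ⟨s, h, h'⟩ := hv
    simp only [Finset.mem_biUnion, Finset.mem_univ, true_and, Finset.mem_image,
      Finset.mem_filter]
    refine ⟨s, v s, h, ?_⟩
    ext t
    by_cases ht : t = s
    · subst ht; simp
    · simp [ht, h' t ht]
  rw [← SimpleGraph.card_neighborFinset_eq_degree]
  refine (Finset.card_le_card hsub).trans ?_
  refine (Finset.card_biUnion_le_card_mul _ _ 4 fun s _ => ?_).trans (by simp [mul_comm])
  exact Finset.card_image_le.trans (card_cycleDist_eq_one_le _)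

/-- The displacement from `x` to `y` on the cycle, of absolute value at most `m` if possible. -/
def cycleDisplacement {n : ℕ} (m : ℕ) (x y : Fin n) : ℤ :=
  if ((x : ℤ) - (y : ℤ)).natAbs ≤ m then (y : ℤ) - x
  else if (x : ℤ) < y then (y : ℤ) - x - n else (y : ℤ) - x + n

theorem card_cycleDist_le_le {n : ℕ} (x : Fin n) (m : ℕ) :
    (Finset.univ.filter fun y => cycleDist x y ≤ m).card ≤ 2 * m + 1 := by
  have h : (Finset.univ.filter fun y => cycleDist x y ≤ m).card ≤
      (Finset.Icc (-(m : ℤ)) m).card := by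
    refine Finset.card_le_card_of_injOn (cycleDisplacement m x) ?_ ?_
    · intro y hy
      replace hy : cycleDist x y ≤ m := by simpa using hy
      unfold cycleDist at hy
      simp only [Finset.coe_Icc, Set.mem_Icc, cycleDisplacement]
      split_ifs <;> omega
    · intro y _ z _ h
      simp only [cycleDisplacement] at h
      have := y.2
      have := z.2
      have := x.2
      apply Fin.ext
      split_ifs at h <;> omega
  refine h.trans ?_
  rw [Int.card_Icc]
  omega

/-- As long as `2m + 1 ≤ n` the ball does not overlap itself around the cycle, so every displacement
in `[-m, m]` occurs. -/
theorem le_card_cycleDist_le {n : ℕ} (x : Fin n) (m : ℕ) (hm : 2 * m + 1 ≤ n) :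
    2 * m + 1 ≤ (Finset.univ.filter fun y => cycleDist x y ≤ m).card := by
  have h : (Finset.Icc (-(m : ℤ)) m).card ≤
      (Finset.univ.filter fun y => cycleDist x y ≤ m).card := by
    refine Finset.card_le_card_of_surjOn (cycleDisplacement m x) ?_
    intro z hz
    simp only [Finset.coe_Icc, Set.mem_Icc] at hz
    have hx := x.2
    obtain ⟨y, hy, hyz⟩ : ∃ y : ℤ, (0 ≤ y ∧ y < n) ∧
        (y = x + z ∨ y = x + z + n ∨ y = x + z - n) := by
      by_cases h1 : (x : ℤ) + z < 0
      · exact ⟨_, by omega, Or.inr (Or.inl rfl)⟩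
      · by_cases h2 : (n : ℤ) ≤ x + z
        · exact ⟨_, by omega, Or.inr (Or.inr rfl)⟩
        · exact ⟨_, by omega, Or.inl rfl⟩
    lift y to ℕ using hy.1
    refine ⟨⟨y, by omega⟩, ?_, ?_⟩
    · suffices h : cycleDist x ⟨y, by omega⟩ ≤ m by simpa using h
      simp only [cycleDist]
      omega
    · simp only [cycleDisplacement]
      split_ifs <;> omega
  refine le_trans ?_ h
  rw [Int.card_Icc]
  omega

theorem card_torusDist_le_eq_prod {d n : ℕ} (u : TorusVertex d n) (m : ℕ) :
    (Finset.univ.filter fun v => torusDist u v ≤ m).card =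
      ∏ s, (Finset.univ.filter fun y => cycleDist (u s) y ≤ m).card := by
  rw [← Fintype.card_piFinset]
  congr 1
  ext v
  simp [torusDist, Finset.sup_le_iff]

/-- The vertices at distance between `α n` and `β n` from `u`. -/
noncomputable def torusAnnulus {d n : ℕ} (α β : ℝ) (u : TorusVertex d n) :
    Finset (TorusVertex d n) :=
  open Classical in
  Finset.univ.filter fun v => α * n ≤ (torusDist u v : ℝ) ∧ (torusDist u v : ℝ) ≤ β * n

/-- The ball of radius `⌊βn⌋` is covered by the annulus and the ball of radius `⌊αn⌋`, and balls are
products of cycle balls. The `∓1` absorb the floors. -/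
theorem le_card_torusAnnulus {d n : ℕ} {α β : ℝ} (hα : 0 ≤ α) (hβ : 1 ≤ 2 * β * n)
    (hβn : 2 * β * n + 1 ≤ n) (u : TorusVertex d n) :
    (2 * β * n - 1) ^ d - (2 * α * n + 1) ^ d ≤ ((torusAnnulus α β u).card : ℝ) := by
  classical
  have hβ0 : 0 ≤ β * n := by linarith
  have h1 : (2 * β * n - 1) ^ d ≤
      ((Finset.univ.filter fun v => torusDist u v ≤ ⌊β * n⌋₊).card : ℝ) := by
    rw [card_torusDist_le_eq_prod, Nat.cast_prod]
    calc (2 * β * n - 1) ^ d = ∏ s : Fin d, (2 * β * n - 1) := by simp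
      _ ≤ _ := by
        refine Finset.prod_le_prod (fun _ _ => by linarith) fun s _ => ?_
        have h2 : 2 * ⌊β * n⌋₊ + 1 ≤ n := by
          have := Nat.floor_le hβ0
          have : ((2 * ⌊β * n⌋₊ + 1 : ℕ) : ℝ) ≤ n := by push_cast; linarith
          exact_mod_cast this
        have h3 : ((2 * ⌊β * n⌋₊ + 1 : ℕ) : ℝ) ≤ _ :=
          Nat.cast_le.2 (le_card_cycleDist_le (u s) _ h2)
        refine le_trans ?_ h3
        have := Nat.lt_floor_add_one (β * n)
        push_cast
        linarith
  have h2 : ((Finset.univ.filter fun v => torusDist u v ≤ ⌊α * n⌋₊).card : ℝ) ≤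
      (2 * α * n + 1) ^ d := by
    rw [card_torusDist_le_eq_prod, Nat.cast_prod]
    calc _ ≤ ∏ s : Fin d, (2 * α * n + 1) := by
          refine Finset.prod_le_prod (fun _ _ => by positivity) fun s _ => ?_
          have h3 : _ ≤ ((2 * ⌊α * n⌋₊ + 1 : ℕ) : ℝ) :=
            Nat.cast_le.2 (card_cycleDist_le_le (u s) _)
          refine h3.trans ?_
          have := Nat.floor_le (show 0 ≤ α * n by positivity)
          push_cast
          linarith
      _ = _ := by simp
  have h3 : (Finset.univ.filter fun v => torusDist u v ≤ ⌊β * n⌋₊) ⊆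
      torusAnnulus α β u ∪ Finset.univ.filter fun v => torusDist u v ≤ ⌊α * n⌋₊ := by
    intro v hv
    simp only [Finset.mem_filter, Finset.mem_univ, true_and, Finset.mem_union,
      torusAnnulus] at hv ⊢
    by_cases h : α * n ≤ (torusDist u v : ℝ)
    · exact Or.inl ⟨h, (Nat.le_floor_iff hβ0).1 hv⟩
    · exact Or.inr (Nat.le_floor (not_le.1 h).le)
  have h4 := (Finset.card_le_card h3).trans (Finset.card_union_le _ _)
  have h5 : ((Finset.univ.filter fun v => torusDist u v ≤ ⌊β * n⌋₊).card : ℝ) ≤ _ :=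
    Nat.cast_le.2 h4
  push_cast at h5
  linarith

theorem eventually_le_card_torusAnnulus {d : ℕ} {α β γ : ℝ} (hα : 0 < α) (hαβ : α < β)
    (hβ : β < 1 / 2) (hγ : γ < (2 * β) ^ d - (2 * α) ^ d) :
    ∀ᶠ n : ℕ in atTop, ∀ u : TorusVertex d n,
      γ * (n : ℝ) ^ d ≤ ((torusAnnulus α β u).card : ℝ) := by
  have hinv : Tendsto (fun n : ℕ => ((n : ℝ))⁻¹) atTop (𝓝 0) :=
    tendsto_inv_atTop_zero.comp tendsto_natCast_atTop_atTop
  have hlim : Tendsto (fun n : ℕ => (2 * β - (n : ℝ)⁻¹) ^ d - (2 * α + (n : ℝ)⁻¹) ^ d) atTop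
      (𝓝 ((2 * β) ^ d - (2 * α) ^ d)) := by
    simpa using ((tendsto_const_nhds.sub hinv).pow d).sub ((tendsto_const_nhds.add hinv).pow d)
  have hinv1 := hinv.eventually_lt_const (show 0 < 2 * β by linarith)
  have hinv2 := hinv.eventually_lt_const (show 0 < 1 - 2 * β by linarith)
  filter_upwards [hlim.eventually_const_lt hγ, hinv1, hinv2, eventually_gt_atTop 0]
    with n h1 h2 h3 hn u
  have hn' : (0 : ℝ) < n := by exact_mod_cast hn
  have hnn : (n : ℝ)⁻¹ * n = 1 := inv_mul_cancel₀ hn'.ne'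
  have h4 := mul_lt_mul_of_pos_right h2 hn'
  have h5 := mul_lt_mul_of_pos_right h3 hn'
  rw [hnn] at h4 h5
  refine le_trans ?_ (le_card_torusAnnulus hα.le h4.le (by linarith) u)
  have h6 := mul_le_mul_of_nonneg_right h1.le (pow_nonneg hn'.le d)
  rw [sub_mul ((2 * β - (n : ℝ)⁻¹) ^ d), ← mul_pow, ← mul_pow, sub_mul, add_mul, hnn] at h6
  exact h6

end Torus

/-! ### From sets of at most half of the vertices to `isoHat`. -/

section Isoperimetry

theorem edgeBoundary_eq_card {V : Type*} [Fintype V] [DecidableEq V] (G : SimpleGraph V)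
    [DecidableRel G.Adj] (S : Finset V) : edgeBoundary G S = (G.interedges S Sᶜ).card := by
  unfold edgeBoundary
  congr!

theorem edgeBoundary_compl {V : Type*} [Fintype V] [DecidableEq V] (G : SimpleGraph V)
    (S : Finset V) : edgeBoundary G Sᶜ = edgeBoundary G S := by
  classical
  unfold edgeBoundary
  refine Finset.card_bij (fun e _ => e.swap) ?_ (fun _ _ _ _ h => Prod.swap_injective h) ?_
  · rintro ⟨x, y⟩ h
    simp only [SimpleGraph.mk_mem_interedges_iff, Finset.mem_compl, not_not, Prod.swap_prod_mk]
      at h ⊢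
    exact ⟨h.2.1, h.1, h.2.2.symm⟩
  · rintro ⟨x, y⟩ h
    simp only [SimpleGraph.mk_mem_interedges_iff, Finset.mem_compl] at h
    refine ⟨(y, x), ?_, rfl⟩
    simp only [SimpleGraph.mk_mem_interedges_iff, Finset.mem_compl, not_not]
    exact ⟨h.2.1, h.1, h.2.2.symm⟩

open Classical in
/-- The number of edges leaving `S` is at most the volume of `S`. -/
theorem edgeBoundary_le_vol {V : Type*} [Fintype V] (G : SimpleGraph V) (S : Finset V) :
    edgeBoundary G S ≤ vol G S := by
  unfold edgeBoundary vol
  have h : G.interedges S Sᶜ ⊆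
      S.biUnion fun u => (G.neighborFinset u).image (Prod.mk u) := by
    rintro ⟨x, y⟩ h
    simp only [SimpleGraph.mk_mem_interedges_iff] at h
    simp [h.1, h.2.2]
  refine (Finset.card_le_card h).trans (Finset.card_biUnion_le.trans ?_)
  exact Finset.sum_le_sum fun u _ => Finset.card_image_le.trans (by simp)

open Classical in
/-- An isoperimetric inequality for the sets of at most half of the vertices, and a bound for the
degrees, bound `isoHat` from below. -/
theorem le_isoHat {V : Type*} [Fintype V] (G : SimpleGraph V) {a b D : ℝ} (ha : 0 < a)
    (ha1 : a < 1) (hb : 0 < b) (hD : 0 < D) (hV : 1 ≤ (1 - a) * Fintype.card V)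
    (hdeg : ∀ u, (G.degree u : ℝ) ≤ D)
    (hE : ∀ T : Finset V, T.Nonempty → 2 * T.card ≤ Fintype.card V →
      b * T.card ≤ edgeBoundary G T) :
    a * b / D ≤ isoHat G a := by
  have hV0 : (0 : ℝ) < Fintype.card V := by
    by_contra h
    nlinarith
  have : Nonempty V := Fintype.card_pos_iff.1 (by exact_mod_cast hV0)
  have : Nonempty {S : Finset V // S.Nonempty ∧ (S.card : ℝ) ≤ (1 - a) * Fintype.card V} :=
    ⟨⟨{Classical.arbitrary V}, by simp, by simpa using hV⟩⟩
  refine le_ciInf fun ⟨S, hS, hSa⟩ => ?_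
  have hS0 : (0 : ℝ) < S.card := by exact_mod_cast hS.card_pos
  have hvol : (vol G S : ℝ) ≤ S.card * D := by
    unfold vol
    push_cast
    simpa using Finset.sum_le_card_nsmul S (fun u => (G.degree u : ℝ)) D fun u _ => hdeg u
  have hbd : b * (a * S.card) ≤ edgeBoundary G S := by
    by_cases h : 2 * S.card ≤ Fintype.card V
    · refine le_trans ?_ (hE S hS h)
      gcongr
      nlinarith
    · have hc : (Sᶜ.card : ℝ) = Fintype.card V - S.card := by
        rw [Finset.card_compl, Nat.cast_sub (Finset.card_le_univ S)]
      have hSV : (S.card : ℝ) ≤ Fintype.card V := by exact_mod_cast Finset.card_le_univ S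
      -- `|Sᶜ| ≥ a|V| ≥ a|S|`: passing to the complement costs only the factor `a`.
      have hle : a * S.card ≤ Sᶜ.card := by rw [hc]; nlinarith
      have hc0 : (0 : ℝ) < Sᶜ.card := lt_of_lt_of_le (by positivity) hle
      rw [← edgeBoundary_compl]
      refine le_trans ?_ (hE Sᶜ (Finset.card_pos.1 (by exact_mod_cast hc0)) ?_)
      · gcongr
      · rw [Finset.card_compl]
        omega
  -- Rules out a zero volume, for which the quotient would take the default value `0`.
  have hpos : (0 : ℝ) < edgeBoundary G S := lt_of_lt_of_le (by positivity) hbd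
  have hvolpos : (0 : ℝ) < vol G S :=
    hpos.trans_le (Nat.cast_le.2 (edgeBoundary_le_vol G S))
  rw [div_le_div_iff₀ hD hvolpos]
  calc a * b * vol G S ≤ a * b * (S.card * D) := by gcongr
    _ = b * (a * S.card) * D := by ring
    _ ≤ _ := by gcongr

end Isoperimetry

/-! ### Admissible pairs, edge boundaries and degrees. -/

section LongEdges

variable {d n : ℕ}

theorem torusDist_comm (u v : TorusVertex d n) : torusDist u v = torusDist v u := by
  simp only [torusDist, cycleDist_comm]

open Classical in
/-- The pairs that may carry a long edge and have exactly one end in `T`. -/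
noncomputable def crossingPairs (α β : ℝ) (T : Finset (TorusVertex d n)) :
    Finset (Sym2 (TorusVertex d n)) :=
  ((T ×ˢ Tᶜ).filter fun e => e.2 ∈ torusAnnulus α β e.1).image fun e => s(e.1, e.2)

open Classical in
/-- The pairs that may carry a long edge at `u`. -/
noncomputable def incidentPairs (α β : ℝ) (u : TorusVertex d n) :
    Finset (Sym2 (TorusVertex d n)) :=
  (torusAnnulus α β u).image fun v => s(u, v)

theorem mem_longPairs_of_mem_torusAnnulus {α β : ℝ} {u v : TorusVertex d n}
    (h : v ∈ torusAnnulus α β u) : s(u, v) ∈ longPairs d n α β :=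
  ⟨u, v, rfl, by simpa [torusAnnulus] using h⟩

theorem mem_torusAnnulus_of_mem_longPairs {α β : ℝ} {u v : TorusVertex d n}
    (h : s(u, v) ∈ longPairs d n α β) : v ∈ torusAnnulus α β u := by
  obtain ⟨u', v', h, h1, h2⟩ := h
  rcases Sym2.eq_iff.1 h with ⟨rfl, rfl⟩ | ⟨rfl, rfl⟩
  · simpa [torusAnnulus] using ⟨h1, h2⟩
  · rw [torusDist_comm] at h1 h2
    simpa [torusAnnulus] using ⟨h1, h2⟩

theorem crossingPairs_subset_longPairs (α β : ℝ) (T : Finset (TorusVertex d n)) :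
    (crossingPairs α β T : Set (Sym2 (TorusVertex d n))) ⊆ longPairs d n α β := by
  classical
  intro e he
  simp only [crossingPairs, Finset.coe_image, Set.mem_image, Finset.mem_coe,
    Finset.mem_filter] at he
  obtain ⟨e, he, rfl⟩ := he
  exact mem_longPairs_of_mem_torusAnnulus he.2

theorem incidentPairs_subset_longPairs (α β : ℝ) (u : TorusVertex d n) :
    (incidentPairs α β u : Set (Sym2 (TorusVertex d n))) ⊆ longPairs d n α β := by
  classical
  intro e he
  simp only [incidentPairs, Finset.coe_image, Set.mem_image, Finset.mem_coe] at he
  obtain ⟨v, hv, rfl⟩ := he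
  exact mem_longPairs_of_mem_torusAnnulus hv

theorem card_incidentPairs_le (α β : ℝ) (u : TorusVertex d n) :
    (incidentPairs α β u).card ≤ n ^ d := by
  classical
  refine Finset.card_image_le.trans ((Finset.card_le_univ _).trans ?_)
  simp

theorem sym2_mk_eq_of_mem_prod_compl {V : Type*} [Fintype V] [DecidableEq V] {T : Finset V}
    {e e' : V × V} (he : e ∈ T ×ˢ Tᶜ) (he' : e' ∈ T ×ˢ Tᶜ)
    (h : s(e.1, e.2) = s(e'.1, e'.2)) : e = e' := by
  simp only [Finset.mem_product, Finset.mem_compl] at he he'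
  rcases Sym2.eq_iff.1 h with ⟨h1, h2⟩ | ⟨h1, h2⟩
  · exact Prod.ext h1 h2
  · exact absurd (h1 ▸ he.1) he'.2

/-- At most `|T| ≤ n^d / 2` of the partners of a vertex of `T` lie in `T`. This is where `Γ > 1/2`
matters. -/
theorem le_card_crossingPairs {α β γ : ℝ}
    (hA : ∀ u : TorusVertex d n, γ * (n : ℝ) ^ d ≤ ((torusAnnulus α β u).card : ℝ))
    {T : Finset (TorusVertex d n)} (hT : 2 * T.card ≤ n ^ d) :
    (γ - 1 / 2) * (n : ℝ) ^ d * T.card ≤ ((crossingPairs α β T).card : ℝ) := by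
  classical
  have hcard : (crossingPairs α β T).card = ∑ u ∈ T, (torusAnnulus α β u \ T).card := by
    unfold crossingPairs
    rw [Finset.card_image_of_injOn, ← Finset.card_sigma]
    · refine Finset.card_bij (fun e _ => ⟨e.1, e.2⟩) ?_ ?_ ?_
      · rintro ⟨x, y⟩ h
        simp only [Finset.mem_filter, Finset.mem_product, Finset.mem_compl] at h
        simp [h.1.1, h.1.2, h.2]
      · rintro ⟨x, y⟩ _ ⟨x', y'⟩ _ h
        simpa using h
      · rintro ⟨x, y⟩ h
        simp only [Finset.mem_sigma, Finset.mem_sdiff] at h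
        exact ⟨(x, y), by simp [h.1, h.2.1, h.2.2], rfl⟩
    · intro e he e' he' h
      rw [Finset.mem_coe, Finset.mem_filter] at he he'
      exact sym2_mk_eq_of_mem_prod_compl he.1 he'.1 h
  rw [hcard, Nat.cast_sum, mul_comm, ← nsmul_eq_mul]
  refine Finset.card_nsmul_le_sum _ _ _ fun u _ => ?_
  have h1 := hA u
  have h2 : ((torusAnnulus α β u).card : ℝ) ≤ ((torusAnnulus α β u \ T).card : ℝ) + T.card := by
    exact_mod_cast Finset.card_le_card_sdiff_add_card
  have h3 : 2 * (T.card : ℝ) ≤ (n : ℝ) ^ d := by exact_mod_cast hT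
  linarith

open Classical in
theorem card_crossingPairs_filter_le_edgeBoundary (α β : ℝ) (T : Finset (TorusVertex d n))
    (L : Set (Sym2 (TorusVertex d n))) :
    ((crossingPairs α β T).filter (· ∈ L)).card ≤ edgeBoundary (nwGraph d n L) T := by
  have hsub : (crossingPairs α β T).filter (· ∈ L) ⊆
      ((nwGraph d n L).interedges T Tᶜ).image fun e => s(e.1, e.2) := by
    intro e he
    simp only [crossingPairs, Finset.mem_filter, Finset.mem_image, Finset.mem_product] at he
    obtain ⟨⟨⟨x, y⟩, ⟨h, -⟩, rfl⟩, hL⟩ := he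
    refine Finset.mem_image.2 ⟨(x, y), ?_, rfl⟩
    rw [SimpleGraph.mk_mem_interedges_iff]
    refine ⟨h.1, h.2, ?_⟩
    rw [nwGraph, SimpleGraph.sup_adj, SimpleGraph.fromEdgeSet_adj]
    refine Or.inr ⟨hL, ?_⟩
    rintro rfl
    simp [h.1] at h
  rw [edgeBoundary_eq_card]
  exact (Finset.card_le_card hsub).trans Finset.card_image_le

open Classical in
theorem card_torusGraph_interedges_le_edgeBoundary (T : Finset (TorusVertex d n))
    (L : Set (Sym2 (TorusVertex d n))) :
    ((torusGraph d n).interedges T Tᶜ).card ≤ edgeBoundary (nwGraph d n L) T := by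
  rw [edgeBoundary_eq_card]
  refine Finset.card_le_card ?_
  rintro ⟨x, y⟩ h
  rw [SimpleGraph.mk_mem_interedges_iff] at h ⊢
  exact ⟨h.1, h.2.1, Or.inl h.2.2⟩

open Classical in
theorem nwGraph_degree_le {α β : ℝ} {L : Set (Sym2 (TorusVertex d n))}
    (hL : L ⊆ longPairs d n α β) (u : TorusVertex d n) :
    (nwGraph d n L).degree u ≤ 4 * d + ((incidentPairs α β u).filter (· ∈ L)).card := by
  have hinj : Function.Injective fun v : TorusVertex d n => s(u, v) :=
    fun v w h => Sym2.congr_right.1 h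
  have hsub : (nwGraph d n L).neighborFinset u ⊆ (torusGraph d n).neighborFinset u ∪
      Finset.univ.filter fun v => s(u, v) ∈ (incidentPairs α β u).filter (· ∈ L) := by
    intro v hv
    rw [SimpleGraph.mem_neighborFinset, nwGraph, SimpleGraph.sup_adj,
      SimpleGraph.fromEdgeSet_adj] at hv
    rw [Finset.mem_union, SimpleGraph.mem_neighborFinset]
    refine hv.imp_right fun h => ?_
    simp only [Finset.mem_filter, Finset.mem_univ, true_and]
    exact ⟨Finset.mem_image_of_mem _ (mem_torusAnnulus_of_mem_longPairs (hL h.1)), h.1⟩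
  rw [← SimpleGraph.card_neighborFinset_eq_degree]
  refine (Finset.card_le_card hsub).trans ((Finset.card_union_le _ _).trans ?_)
  refine add_le_add ?_ ?_
  · rw [SimpleGraph.card_neighborFinset_eq_degree]
    exact torusGraph_degree_le u
  · exact Finset.card_le_card_of_injOn _ (fun v hv => by simpa using hv) hinj.injOn

end LongEdges

/-! ### Union bounds for the random graph. -/

section Random

variable {d n : ℕ} {α β σ ζ : ℝ}

theorem longEdgeLaw_isProbabilityMeasure (d n : ℕ) (α β σ ζ : ℝ) :
    IsProbabilityMeasure (longEdgeLaw d n α β σ ζ) := by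
  unfold longEdgeLaw
  infer_instance

open Classical in
/-- Union bound over the vertices for the numbers of long edges. -/
theorem longEdgeLaw_real_exists_incidentPairs_le (t : ℝ) :
    (longEdgeLaw d n α β σ ζ).real
      {L | ∃ u, t ≤ (((incidentPairs α β u).filter (· ∈ L)).card : ℝ)} ≤
      (n : ℝ) ^ d * Real.exp (2 * (longEdgeProb d n σ ζ * (n : ℝ) ^ d) - t) := by
  have hunion : {L : Set (Sym2 (TorusVertex d n)) |
      ∃ u, t ≤ (((incidentPairs α β u).filter (· ∈ L)).card : ℝ)} =
      ⋃ u, {L | t ≤ (((incidentPairs α β u).filter (· ∈ L)).card : ℝ)} := by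
    ext; simp
  rw [hunion]
  refine (measureReal_iUnion_fintype_le _).trans ?_
  refine (Finset.sum_le_card_nsmul _ _
    (Real.exp (2 * (longEdgeProb d n σ ζ * (n : ℝ) ^ d) - t)) fun u _ => ?_).trans (by simp)
  refine (setBernoulli_real_card_ge_le _ _ _ (incidentPairs_subset_longPairs α β u) t).trans ?_
  rw [Real.exp_le_exp]
  have h1 : ((incidentPairs α β u).card : ℝ) ≤ (n : ℝ) ^ d := by
    exact_mod_cast card_incidentPairs_le α β u
  have h2 := (longEdgeProb d n σ ζ).2.1
  gcongr

open Classical in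
/-- Union bound over the sets of `s` for the numbers of long edges leaving them. -/
theorem longEdgeLaw_real_exists_crossingPairs_le (s : Finset (Finset (TorusVertex d n)))
    (t : Finset (TorusVertex d n) → ℝ) :
    (longEdgeLaw d n α β σ ζ).real
      {L | ∃ T ∈ s, (((crossingPairs α β T).filter (· ∈ L)).card : ℝ) ≤ t T} ≤
      ∑ T ∈ s, Real.exp (t T - longEdgeProb d n σ ζ * (crossingPairs α β T).card / 2) := by
  have hunion : {L : Set (Sym2 (TorusVertex d n)) |
      ∃ T ∈ s, (((crossingPairs α β T).filter (· ∈ L)).card : ℝ) ≤ t T} =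
      ⋃ T ∈ s, {L | (((crossingPairs α β T).filter (· ∈ L)).card : ℝ) ≤ t T} := by
    ext; simp
  rw [hunion]
  refine (measureReal_biUnion_finset_le _ _).trans (Finset.sum_le_sum fun T _ => ?_)
  exact setBernoulli_real_card_le_le _ _ _ (crossingPairs_subset_longPairs α β T) _

/-- The balance in each union bound: weight `n^{-(k+1)}` against `n^k` elements, with `k = d` for
vertices and `k = 2d` for ordered pairs. -/
theorem pow_mul_exp_neg_log (hn : 0 < n) (k : ℕ) :
    Real.exp (-((k + 1) * Real.log n)) * (n : ℝ) ^ k = (n : ℝ)⁻¹ := by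
  have hn' : (0 : ℝ) < n := by exact_mod_cast hn
  rw [neg_mul_eq_mul_neg, ← Real.log_inv, mul_comm _ (Real.log _), Real.exp_mul, Real.exp_log (inv_pos.2 hn')]
  rw [show ((k : ℝ) + 1) = ((k + 1 : ℕ) : ℝ) by push_cast; rfl, Real.rpow_natCast, pow_succ,
    inv_pow]
  field_simp

open Classical in
/-- Sets with few torus boundary edges have many long edges leaving them. -/
theorem longEdgeLaw_real_exists_edgeBoundary_lt_div_log {γ : ℝ} (hn : 1 ≤ Real.log n)
    (hA : ∀ u : TorusVertex d n, γ * (n : ℝ) ^ d ≤ ((torusAnnulus α β u).card : ℝ))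
    (hp : 2 * (2 * d + 2) ≤ (γ - 1 / 2) * (longEdgeProb d n σ ζ * (n : ℝ) ^ d)) :
    (longEdgeLaw d n α β σ ζ).real {L | ∃ T : Finset (TorusVertex d n), T.Nonempty ∧
      2 * T.card ≤ n ^ d ∧ (edgeBoundary (nwGraph d n L) T : ℝ) < 1 / Real.log n * T.card} ≤
      Real.exp ((n : ℝ)⁻¹) - 1 := by
  have := longEdgeLaw_isProbabilityMeasure d n α β σ ζ
  have hn0 : 0 < n := by
    rcases Nat.eq_zero_or_pos n with rfl | h
    · simp at hn; linarith
    · exact h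
  have hlog : 0 < Real.log n := by linarith
  -- Only sets with small torus boundary can fail, so only they enter the union bound.
  set s : Finset (Finset (TorusVertex d n)) := Finset.univ.filter fun T =>
    T.Nonempty ∧ 2 * T.card ≤ n ^ d ∧
      (((torusGraph d n).interedges T Tᶜ).card : ℝ) < 1 / Real.log n * T.card with hs
  have hsub : {L | ∃ T : Finset (TorusVertex d n), T.Nonempty ∧
      2 * T.card ≤ n ^ d ∧ (edgeBoundary (nwGraph d n L) T : ℝ) < 1 / Real.log n * T.card} ⊆
      {L | ∃ T ∈ s, (((crossingPairs α β T).filter (· ∈ L)).card : ℝ) ≤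
        1 / Real.log n * T.card} := by
    rintro L ⟨T, hT, hT2, hb⟩
    refine ⟨T, ?_, ?_⟩
    · rw [hs, Finset.mem_filter]
      exact ⟨Finset.mem_univ _, hT, hT2, lt_of_le_of_lt
        (Nat.cast_le.2 (card_torusGraph_interedges_le_edgeBoundary T L)) hb⟩
    · exact (Nat.cast_le.2 (card_crossingPairs_filter_le_edgeBoundary α β T L)).trans hb.le
  refine (measureReal_mono hsub).trans ((longEdgeLaw_real_exists_crossingPairs_le s _).trans ?_)
  have hne : ∀ T ∈ s, ((torusGraph d n).interedges T Tᶜ).Nonempty := by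
    intro T hT
    rw [hs, Finset.mem_filter] at hT
    have hT0 := hT.2.1.card_pos
    refine (torusGraph_preconnected d n).interedges_compl_nonempty hT.2.1 ?_
    rw [← Finset.card_pos, Finset.card_compl]
    have : Fintype.card (TorusVertex d n) = n ^ d := by simp
    omega
  have hx : Real.exp (-((2 * d + 1) * Real.log n)) * Fintype.card
      (TorusVertex d n × TorusVertex d n) = (n : ℝ)⁻¹ := by
    rw [← pow_mul_exp_neg_log hn0 (2 * d)]
    simp [two_mul, pow_add]
  rw [← hx]
  refine le_trans (Finset.sum_le_sum fun T hT => ?_)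
    (sum_pow_card_le_exp s (fun T => (torusGraph d n).interedges T Tᶜ) ?_ hne
      (Real.exp_pos _).le)
  · rw [hs, Finset.mem_filter] at hT
    -- The exponent is at most `|T| - (2d+2)|T| = -(2d+1)|T|`, and `|T| > |D| ln n` for the torus
    -- boundary `D` of `T`.
    rw [← Real.exp_nat_mul, Real.exp_le_exp]
    have h1 := le_card_crossingPairs hA hT.2.2.1
    have h2 := mul_le_mul_of_nonneg_left h1 (longEdgeProb d n σ ζ).2.1
    have h3 := mul_le_mul_of_nonneg_right hp (Nat.cast_nonneg (α := ℝ) T.card)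
    have h4 : 1 / Real.log n * T.card ≤ T.card :=
      mul_le_of_le_one_left (Nat.cast_nonneg _) ((div_le_one hlog).2 hn)
    have h5 := hT.2.2.2
    rw [one_div_mul_eq_div, lt_div_iff₀ hlog] at h5
    have h6 := mul_le_mul_of_nonneg_left h5.le (show (0 : ℝ) ≤ 2 * d + 1 by positivity)
    linarith
  · intro T hT T' hT' h
    exact (torusGraph_preconnected d n).eq_of_interedges_compl_eq (hne T hT) h

open Classical in
/-- For large edge probabilities the long edges alone give expansion. -/
theorem longEdgeLaw_real_exists_edgeBoundary_lt {γ c : ℝ} (hn : 0 < n)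
    (hA : ∀ u : TorusVertex d n, γ * (n : ℝ) ^ d ≤ ((torusAnnulus α β u).card : ℝ))
    (hc : (d + 1) * Real.log n ≤ c)
    (hp : 4 * c ≤ (γ - 1 / 2) * (longEdgeProb d n σ ζ * (n : ℝ) ^ d)) :
    (longEdgeLaw d n α β σ ζ).real {L | ∃ T : Finset (TorusVertex d n), T.Nonempty ∧
      2 * T.card ≤ n ^ d ∧ (edgeBoundary (nwGraph d n L) T : ℝ) < c * T.card} ≤
      Real.exp ((n : ℝ)⁻¹) - 1 := by
  have := longEdgeLaw_isProbabilityMeasure d n α β σ ζ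
  set s : Finset (Finset (TorusVertex d n)) := Finset.univ.filter fun T =>
    T.Nonempty ∧ 2 * T.card ≤ n ^ d with hs
  have hsub : {L | ∃ T : Finset (TorusVertex d n), T.Nonempty ∧
      2 * T.card ≤ n ^ d ∧ (edgeBoundary (nwGraph d n L) T : ℝ) < c * T.card} ⊆
      {L | ∃ T ∈ s, (((crossingPairs α β T).filter (· ∈ L)).card : ℝ) ≤ c * T.card} := by
    rintro L ⟨T, hT, hT2, hb⟩
    refine ⟨T, by simp [hs, hT, hT2], ?_⟩
    exact (Nat.cast_le.2 (card_crossingPairs_filter_le_edgeBoundary α β T L)).trans hb.le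
  refine (measureReal_mono hsub).trans ((longEdgeLaw_real_exists_crossingPairs_le s _).trans ?_)
  have hx : Real.exp (-((d + 1) * Real.log n)) * Fintype.card (TorusVertex d n) =
      (n : ℝ)⁻¹ := by
    rw [← pow_mul_exp_neg_log hn d]
    simp
  rw [← hx]
  refine le_trans (Finset.sum_le_sum fun T hT => ?_)
    (sum_pow_card_le_exp s id Function.injective_id.injOn
      (fun T hT => (Finset.mem_filter.1 hT).2.1) (Real.exp_pos _).le)
  rw [hs, Finset.mem_filter] at hT
  -- Here `T` is its own code; the exponent is at most `c|T| - 2c|T| ≤ -(d+1)|T| ln n`.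
  rw [← Real.exp_nat_mul, Real.exp_le_exp, id]
  have h1 := le_card_crossingPairs hA hT.2.2
  have h2 := mul_le_mul_of_nonneg_left h1 (longEdgeProb d n σ ζ).2.1
  have h3 := mul_le_mul_of_nonneg_right hp (Nat.cast_nonneg (α := ℝ) T.card)
  have h4 := mul_le_mul_of_nonneg_right hc (Nat.cast_nonneg (α := ℝ) T.card)
  linarith

/-- A bound for the degrees holds with high probability; together with expansion of the sets of at
most half of the vertices it bounds `isoHat` from below. -/
theorem le_probIsoHatGe {a b r f : ℝ} (ha : 0 < a) (ha1 : a < 1) (hb : 0 < b) (hσ : 0 < σ)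
    (hn : 1 ≤ Real.log n) (hf : Real.log n ≤ f)
    (hV : 1 ≤ (1 - a) * (n : ℝ) ^ d)
    (hp : longEdgeProb d n σ ζ * (n : ℝ) ^ d ≤ σ * f)
    (hE : (longEdgeLaw d n α β σ ζ).real {L | ∃ T : Finset (TorusVertex d n), T.Nonempty ∧
      2 * T.card ≤ n ^ d ∧ (edgeBoundary (nwGraph d n L) T : ℝ) < b * T.card} ≤ r) :
    1 - r - (n : ℝ)⁻¹ ≤
      probIsoHatGe d n α β σ ζ a (a * b / ((5 * d + 2 * σ + 1) * f)) := by
  classical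
  have := longEdgeLaw_isProbabilityMeasure d n α β σ ζ
  have hn0 : 0 < n := by
    rcases Nat.eq_zero_or_pos n with rfl | h
    · simp at hn; linarith
    · exact h
  have hf1 : 1 ≤ f := hn.trans hf
  -- Chosen so that the degree tail is at most `exp(2σf - t) = exp(-(d+1)f) ≤ n^{-(d+1)}` at each
  -- vertex; with `4d` torus edges, degrees stay below `(5d + 2σ + 1) f`.
  set t : ℝ := (2 * σ + d + 1) * f with ht
  set A := {L : Set (Sym2 (TorusVertex d n)) |
    a * b / ((5 * d + 2 * σ + 1) * f) ≤ isoHat (nwGraph d n L) a}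
  set B := {L : Set (Sym2 (TorusVertex d n)) | ∃ T : Finset (TorusVertex d n), T.Nonempty ∧
      2 * T.card ≤ n ^ d ∧ (edgeBoundary (nwGraph d n L) T : ℝ) < b * T.card}
  set D := {L : Set (Sym2 (TorusVertex d n)) |
    ∃ u, t ≤ (((incidentPairs α β u).filter (· ∈ L)).card : ℝ)}
  set N := {L : Set (Sym2 (TorusVertex d n)) | ¬ L ⊆ longPairs d n α β}
  have hD : (longEdgeLaw d n α β σ ζ).real D ≤ (n : ℝ)⁻¹ := by
    refine (longEdgeLaw_real_exists_incidentPairs_le t).trans ?_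
    rw [← pow_mul_exp_neg_log hn0 d, mul_comm]
    gcongr
    have : (d + 1 : ℝ) * Real.log n ≤ (d + 1) * f := by gcongr
    rw [ht]
    linarith
  have hN : (longEdgeLaw d n α β σ ζ).real N = 0 := by
    rw [measureReal_def, show longEdgeLaw d n α β σ ζ N = 0 from
      ae_iff.1 (setBernoulli_ae_subset (u := longPairs d n α β))]
    simp
  have hcover : Set.univ ⊆ A ∪ (B ∪ (D ∪ N)) := by
    intro L _
    by_contra hL
    simp only [Set.mem_union, not_or] at hL
    obtain ⟨hLA, hLB, hLD, hLN⟩ := hL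
    have hLN' : L ⊆ longPairs d n α β := not_not.1 hLN
    refine hLA (le_isoHat _ ha ha1 hb (by positivity) (by simpa using hV) ?_ ?_)
    · intro u
      have h1 : ((nwGraph d n L).degree u : ℝ) ≤
          4 * d + (((incidentPairs α β u).filter (· ∈ L)).card : ℝ) := by
        exact_mod_cast nwGraph_degree_le hLN' u
      have h2 : (((incidentPairs α β u).filter (· ∈ L)).card : ℝ) < t := by
        by_contra h
        exact hLD ⟨u, not_lt.1 h⟩
      have h3 : 4 * (d : ℝ) * 1 ≤ 4 * d * f := by gcongr
      rw [ht] at h2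
      convert h1.trans _
      linarith
    · intro T hT hT2
      by_contra h
      exact hLB ⟨T, hT, by simpa using hT2, not_le.1 h⟩
  have h1 := measureReal_mono (μ := longEdgeLaw d n α β σ ζ) hcover
  rw [probReal_univ] at h1
  have h2 := measureReal_union_le (μ := longEdgeLaw d n α β σ ζ) A (B ∪ (D ∪ N))
  have h3 := measureReal_union_le (μ := longEdgeLaw d n α β σ ζ) B (D ∪ N)
  have h4 := measureReal_union_le (μ := longEdgeLaw d n α β σ ζ) D N
  change _ ≤ (longEdgeLaw d n α β σ ζ).real A
  linarith

theorem probIsoHatGe_le_one (a b : ℝ) : probIsoHatGe d n α β σ ζ a b ≤ 1 := by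
  have := longEdgeLaw_isProbabilityMeasure d n α β σ ζ
  exact measureReal_le_one

end Random

/-! ### Asymptotics in `n`. -/

section Limits

theorem tendsto_log_natCast_atTop : Tendsto (fun n : ℕ => Real.log n) atTop atTop :=
  Real.tendsto_log_atTop.comp tendsto_natCast_atTop_atTop

/-- Powers of `ln n` are `o(n)`, so the truncation to `[0, 1]` is eventually inactive. -/
theorem eventually_longEdgeProb_mul_pow {d : ℕ} (hd : 1 ≤ d) {σ : ℝ} (hσ : 0 < σ) (ζ : ℝ) :
    ∀ᶠ n : ℕ in atTop,
      longEdgeProb d n σ ζ * (n : ℝ) ^ d = σ * Real.log n ^ ζ := by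
  have ho := (isLittleO_log_rpow_rpow_atTop ζ zero_lt_one).comp_tendsto
    (tendsto_natCast_atTop_atTop (R := ℝ))
  have hb := ho.bound (inv_pos.2 hσ)
  filter_upwards [hb, tendsto_log_natCast_atTop.eventually_ge_atTop 1,
    eventually_ge_atTop 1] with n h1 h2 hn
  have hn' : (1 : ℝ) ≤ n := by exact_mod_cast hn
  have hlog : 0 ≤ Real.log n ^ ζ := Real.rpow_nonneg (by linarith) _
  have hpow : 0 < (n : ℝ) ^ d := by positivity
  simp only [Function.comp_apply, Real.rpow_one, Real.norm_eq_abs, abs_of_nonneg hlog,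
    abs_of_nonneg (zero_le_one.trans hn')] at h1
  have h3 : σ * Real.log n ^ ζ ≤ (n : ℝ) ^ d := by
    calc σ * Real.log n ^ ζ ≤ σ * (σ⁻¹ * n) := by gcongr
      _ = n := by field_simp
      _ ≤ _ := le_self_pow₀ hn' (by omega)
  unfold longEdgeProb
  rw [Set.projIcc_of_mem zero_le_one (x := σ / (n : ℝ) ^ d * Real.log n ^ ζ)]
  · dsimp only
    field_simp
  · refine ⟨by positivity, ?_⟩
    rw [div_mul_eq_mul_div, div_le_one hpow]
    exact h3

theorem tendsto_one_sub_exp_inv :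
    Tendsto (fun n : ℕ => 1 - (Real.exp ((n : ℝ)⁻¹) - 1) - (n : ℝ)⁻¹) atTop (𝓝 1) := by
  have hinv : Tendsto (fun n : ℕ => ((n : ℝ))⁻¹) atTop (𝓝 0) :=
    tendsto_inv_atTop_zero.comp tendsto_natCast_atTop_atTop
  have hexp := (Real.continuous_exp.tendsto 0).comp hinv
  simpa using (tendsto_const_nhds.sub (hexp.sub_const 1)).sub hinv

theorem eventually_one_le_mul_pow {d : ℕ} (hd : 1 ≤ d) {a : ℝ} (ha : a < 1) :
    ∀ᶠ n : ℕ in atTop, 1 ≤ (1 - a) * (n : ℝ) ^ d :=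
  (((tendsto_pow_atTop (by omega)).comp tendsto_natCast_atTop_atTop).const_mul_atTop
    (sub_pos.2 ha)).eventually_ge_atTop 1

variable {d : ℕ} {α β γ σ ζ a : ℝ}

/-- Isoperimetry up to logarithms, when the long edge density exceeds a constant. -/
theorem tendsto_probIsoHatGe_div_log_sq (hd : 1 ≤ d) (hα : 0 < α) (hαβ : α < β)
    (hβ : β < 1 / 2) (hγ : γ < (2 * β) ^ d - (2 * α) ^ d) (hσ : 0 < σ) (hζ : ζ ≤ 1)
    (ha : 0 < a) (ha1 : a < 1)
    (hdens : ∀ᶠ n : ℕ in atTop, 2 * (2 * d + 2) ≤ (γ - 1 / 2) * (σ * Real.log n ^ ζ)) :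
    Tendsto (fun n : ℕ => probIsoHatGe d n α β σ ζ a
      (a / (5 * d + 2 * σ + 1) / Real.log n ^ 2)) atTop (𝓝 1) := by
  refine tendsto_of_tendsto_of_tendsto_of_le_of_le' tendsto_one_sub_exp_inv
    tendsto_const_nhds ?_ (Eventually.of_forall fun n => probIsoHatGe_le_one _ _)
  filter_upwards [hdens, eventually_longEdgeProb_mul_pow hd hσ ζ,
    tendsto_log_natCast_atTop.eventually_ge_atTop 1, eventually_one_le_mul_pow hd ha1,
    eventually_le_card_torusAnnulus hα hαβ hβ hγ] with n h1 h2 h3 h4 h5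
  rw [← h2] at h1
  have hp : longEdgeProb d n σ ζ * (n : ℝ) ^ d ≤ σ * Real.log n := by
    rw [h2]
    gcongr
    simpa using Real.rpow_le_rpow_of_exponent_le h3 hζ
  have hC : a / (5 * d + 2 * σ + 1) / Real.log n ^ 2 =
      a * (1 / Real.log n) / ((5 * d + 2 * σ + 1) * Real.log n) := by
    field_simp
  rw [hC]
  exact le_probIsoHatGe ha ha1 (by positivity) hσ h3 le_rfl h4 hp
    (longEdgeLaw_real_exists_edgeBoundary_lt_div_log h3 h5 h1)

/-- Expansion, when the long edge density exceeds a multiple of the logarithm. -/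
theorem tendsto_probIsoHatGe_const (hd : 1 ≤ d) (hα : 0 < α) (hαβ : α < β)
    (hβ : β < 1 / 2) (hγ : γ < (2 * β) ^ d - (2 * α) ^ d) (hγ' : 1 / 2 < γ)
    (hσ : 0 < σ) (hζ : 1 ≤ ζ) (ha : 0 < a) (ha1 : a < 1)
    (hdens : ∀ᶠ n : ℕ in atTop,
      4 * ((d + 1) * Real.log n) ≤ (γ - 1 / 2) * (σ * Real.log n ^ ζ)) :
    Tendsto (fun n : ℕ => probIsoHatGe d n α β σ ζ a
      (a * ((γ - 1 / 2) * σ / 4) / (5 * d + 2 * σ + 1))) atTop (𝓝 1) := by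
  refine tendsto_of_tendsto_of_tendsto_of_le_of_le' tendsto_one_sub_exp_inv
    tendsto_const_nhds ?_ (Eventually.of_forall fun n => probIsoHatGe_le_one _ _)
  filter_upwards [hdens, eventually_longEdgeProb_mul_pow hd hσ ζ,
    tendsto_log_natCast_atTop.eventually_ge_atTop 1, eventually_one_le_mul_pow hd ha1,
    eventually_le_card_torusAnnulus hα hαβ hβ hγ, eventually_gt_atTop 0] with n h1 h2 h3 h4 h5 h6
  have hf : Real.log n ≤ Real.log n ^ ζ := by
    simpa using Real.rpow_le_rpow_of_exponent_le h3 hζ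
  have hf0 : 0 < Real.log n ^ ζ := by linarith
  have hγ0 : 0 < γ - 1 / 2 := by linarith
  -- Expansion and maximal degree are both of order `(ln n)^ζ`, which cancels.
  have hC : a * ((γ - 1 / 2) * σ / 4) / (5 * d + 2 * σ + 1) =
      a * ((γ - 1 / 2) * σ / 4 * Real.log n ^ ζ) /
        ((5 * d + 2 * σ + 1) * Real.log n ^ ζ) := by
    field_simp
  rw [hC]
  exact le_probIsoHatGe ha ha1 (by positivity) hσ
    h3 hf h4 h2.le
    (longEdgeLaw_real_exists_edgeBoundary_lt h6 h5 (by linarith) (by rw [h2]; linarith))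

theorem eventually_le_mul_log_rpow {ε : ℝ} (c : ℝ) {k : ℝ} (hk : 0 < k) (hε : 0 < ε) :
    ∀ᶠ n : ℕ in atTop, c ≤ k * Real.log n ^ ε :=
  (((tendsto_rpow_atTop hε).comp tendsto_log_natCast_atTop).const_mul_atTop
    hk).eventually_ge_atTop c

end Limits

theorem proposition2p4 (d : ℕ) (hd : 1 ≤ d) (α β : ℝ) (hα : 0 < α) (hαβ : α < β) (hβ : β < 1 / 2)
    (hΓ : 1 / 2 < (2 * β) ^ d - (2 * α) ^ d) :
    -- (i): `0 < ζ < 1` and any `σ > 0`, or `ζ = 0` and `σ` large enough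
    ((∀ ζ σ a : ℝ, 0 < ζ → ζ < 1 → 0 < σ → 0 < a → a < 1 → ∃ C : ℝ, 0 < C ∧
        Tendsto (fun n : ℕ => probIsoHatGe d n α β σ ζ a (C / Real.log n ^ 2)) atTop (𝓝 1)) ∧
      (∃ σ₀ : ℝ, 0 < σ₀ ∧ ∀ σ a : ℝ, σ₀ ≤ σ → 0 < a → a < 1 → ∃ C : ℝ, 0 < C ∧
        Tendsto (fun n : ℕ => probIsoHatGe d n α β σ 0 a (C / Real.log n ^ 2)) atTop (𝓝 1))) ∧
    -- (ii): `ζ > 1` and any `σ > 0`, or `ζ = 1` and `σ` large enough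
    ((∀ ζ σ a : ℝ, 1 < ζ → 0 < σ → 0 < a → a < 1 → ∃ C : ℝ, 0 < C ∧
        Tendsto (fun n : ℕ => probIsoHatGe d n α β σ ζ a C) atTop (𝓝 1)) ∧
      (∃ σ₀ : ℝ, 0 < σ₀ ∧ ∀ σ a : ℝ, σ₀ ≤ σ → 0 < a → a < 1 → ∃ C : ℝ, 0 < C ∧
        Tendsto (fun n : ℕ => probIsoHatGe d n α β σ 1 a C) atTop (𝓝 1))) := by
  -- The gap below `Γ` absorbs lattice errors. As `γ` is fixed before `σ` and `a`, both thresholds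
  -- `σ₀` depend on `d, α, β` only.
  obtain ⟨γ, hγ, hγ'⟩ := exists_between hΓ
  have hγ0 : 0 < γ - 1 / 2 := by linarith
  refine ⟨⟨fun ζ σ a hζ hζ1 hσ ha ha1 => ?_, 2 * (2 * d + 2) / (γ - 1 / 2), by positivity,
    fun σ a hσ ha ha1 => ?_⟩, fun ζ σ a hζ hσ ha ha1 => ?_,
    4 * (d + 1) / (γ - 1 / 2), by positivity, fun σ a hσ ha ha1 => ?_⟩
  · refine ⟨_, by positivity, tendsto_probIsoHatGe_div_log_sq hd hα hαβ hβ hγ' hσ hζ1.le ha ha1 ?_⟩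
    filter_upwards [eventually_le_mul_log_rpow (2 * (2 * d + 2)) (mul_pos hγ0 hσ) hζ] with n hn
    linarith
  · have hσ0 : 0 < σ := lt_of_lt_of_le (by positivity) hσ
    refine ⟨_, by positivity,
      tendsto_probIsoHatGe_div_log_sq hd hα hαβ hβ hγ' hσ0 zero_le_one ha ha1 ?_⟩
    rw [div_le_iff₀ hγ0] at hσ
    filter_upwards with n
    rw [Real.rpow_zero]
    linarith
  · refine ⟨_, by positivity,
      tendsto_probIsoHatGe_const hd hα hαβ hβ hγ' hγ hσ hζ.le ha ha1 ?_⟩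
    -- For `ζ > 1` the surplus factor `(ln n)^{ζ-1}` beats any constant, so no lower bound on `σ` is
    -- needed.
    filter_upwards [eventually_le_mul_log_rpow (4 * (d + 1)) (mul_pos hγ0 hσ) (sub_pos.2 hζ),
      tendsto_log_natCast_atTop.eventually_ge_atTop 1] with n hn hlog
    have hlog0 : 0 < Real.log n := by linarith
    have h := mul_le_mul_of_nonneg_right hn hlog0.le
    rw [Real.rpow_sub_one hlog0.ne', mul_assoc ((γ - 1 / 2) * σ), div_mul_cancel₀ _ hlog0.ne'] at h
    linarith
  · have hσ0 : 0 < σ := lt_of_lt_of_le (by positivity) hσ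
    refine ⟨_, by positivity,
      tendsto_probIsoHatGe_const hd hα hαβ hβ hγ' hγ hσ0 le_rfl ha ha1 ?_⟩
    rw [div_le_iff₀ hγ0] at hσ
    filter_upwards [tendsto_log_natCast_atTop.eventually_ge_atTop 1] with n hlog
    rw [Real.rpow_one]
    have h := mul_le_mul_of_nonneg_right hσ (zero_le_one.trans hlog)
    linarith
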